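/- Fix a real number $q\in(0,1)$ and put $\phi_k(x;1):=\prod_{j=0}^{k-1}(1-2xq^j+q^{2j})$ for $k\ge 0$. For an entire function $f$ let $M(r;f):=\max_{|x|=r}|f(x)|$, and define the log-order of $f$ to be $$\sigma_{\log}:=\limsup_{r\to\infty}\frac{\ln^+\ln^+M(r;f)}{\ln\ln r},\qquad \ln^+ t:=\max\{\ln t,0\},\quad \ln^+0:=0 .$$ Let $f$ be a non-constant entire function with $\sigma_{\log}<2$. Then there is a unique sequence $(a_n)_{n\ge 0}$ of complex numbers such that $\sum_{k=0}^\infty a_k\phi_k(x;1)$ converges to $f$ uniformly on every compact subset of $\mathbb{C}$. For every $r>0$ the maximum $$\mu_q(r;f):=\max_{n\ge 0}\ \max_{|x|=r}|a_n\phi_n(x;1)|$$ (the Askey–Wilson maximal term of $f$) exists and is positive, there is a largest $n\ge 0$ with $\max_{|x|=r}|a_n\phi_n(x;1)|=\mu_q(r;f)$, denoted $\nu_q(r;f)$ (the Askey–Wilson central index of $f$), and $$\sigma_{\log}=\limsup_{r\to\infty}\frac{\ln^+\ln^+\mu_q(r;f)}{\ln\ln r}=1+\limsup_{r\to\infty}\frac{\ln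 \nu_q(r;f)}{\ln\ln r}.$$ -/

import Mathlib

open Filter Topology

noncomputable section

namespace AskeyWilson

/-- The logarithmic order `limsup_{r → ∞} ln⁺ ln⁺ g(r) / ln ln r` of a real function `g`,
as an extended real number. -/
def logOrder (g : ℝ → ℝ) : EReal :=
  limsup (fun r : ℝ => ((Real.posLog (Real.posLog (g r)) / Real.log (Real.log r) : ℝ) : EReal)) atTop

/-- The maximum modulus `M(r; f) = max {|f x| : |x| = r}`
(the supremum is a maximum when `0 ≤ r` and `f` is continuous). -/
def maxModulus (f : ℂ → ℂ) (r : ℝ) : ℝ :=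
  ⨆ x : Metric.sphere (0 : ℂ) r, ‖f x‖

/-- The Askey-Wilson basis polynomial at the point `1`:
`φ_k(x; 1) = ∏_{j < k} (1 - 2 x q ^ j + q ^ (2 j))`. -/
def phi (q : ℝ) (k : ℕ) (x : ℂ) : ℂ :=
  ∏ j ∈ Finset.range k, (1 - 2 * x * (q : ℂ) ^ j + (q : ℂ) ^ (2 * j))

/-- `∑ a_k φ_k(x; 1)` is an Askey-Wilson series expansion of `f`: the series converges to `f`
uniformly on every compact subset of the plane. -/
def IsExpansion (q : ℝ) (f : ℂ → ℂ) (a : ℕ → ℂ) : Prop :=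
  ∀ K : Set ℂ, IsCompact K →
    TendstoUniformlyOn (fun (n : ℕ) (x : ℂ) => ∑ k ∈ Finset.range n, a k * phi q k x) f atTop K

/-- The size `max_{|x| = r} |a_n φ_n(x; 1)|` of the `n`-th term on the circle of radius `r`. -/
def termSize (q : ℝ) (a : ℕ → ℂ) (n : ℕ) (r : ℝ) : ℝ :=
  maxModulus (fun x => a n * phi q n x) r

/-- The Askey-Wilson maximal term `μ_q(r)` of the series with coefficients `a`. -/
def maximalTerm (q : ℝ) (a : ℕ → ℂ) (r : ℝ) : ℝ :=
  ⨆ n : ℕ, termSize q a n r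

/-- The Askey-Wilson central index `ν_q(r)`: the largest index of a term of maximal size. -/
def centralIndex (q : ℝ) (a : ℕ → ℂ) (r : ℝ) : ℕ :=
  sSup {n : ℕ | termSize q a n r = maximalTerm q a r}

end AskeyWilson

end

namespace AskeyWilson

/-! ### Maximum modulus on circles -/

section MaxModulus

/-! The polynomials `phi q n` vanish successively at the nodes `(q^j + q^(-j))/2`, so the expansion
is Newton interpolation at these nodes. Evaluation there gives a triangular system, hence
uniqueness.

For existence, write `f` as a partial sum plus `phi q n * newtonRem q f n`. The maximum principle on
the disc of radius `2 q^(-n)` bounds the remainder factor by `M(2 q^(-n)) q^(n²/2)`. Log-order below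
two makes `ln⁺ M(2 q^(-n))` of size `o(n²)`, so a Gaussian bound `C exp(-c n²)` survives
(`exists_norm_newtonRem_le`). It yields convergence, coefficient decay and `ν(r) ≤ (2/c) ln r`.

The orders agree because, for each `s > 1`, a bound `O((ln r)^s)` passes between `ln⁺ M` and `ln⁺
μ`, and is equivalent for `ln⁺ μ` to `ν = O((ln r)^(s-1))`. The inequalities are `M(r) ≤ r μ(r)`,
`μ(r) ≤ 2^ν M(r + 2 q^(-ν))`, `r^ν ≤ μ(r^B)` and `μ(r) ≤ C (2 + 2r)^ν`, for large `r`. Since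
`q^(-ν)` is at most a power of `r`, all radii stay below some `r^B`, which only multiplies `ln r` by
a constant. Exponents `s > 1` suffice because a nonconstant `f` has a nonzero term of positive
degree, forcing order at least one. -/

theorem norm_le_maxModulus {f : ℂ → ℂ} (hf : Continuous f) {r : ℝ} {x : ℂ} (hx : ‖x‖ = r) :
    ‖f x‖ ≤ maxModulus f r := by
  have hb : BddAbove (Set.range fun x : Metric.sphere (0 : ℂ) r => ‖f x‖) := by
    have := ((isCompact_sphere (0 : ℂ) r).image hf.norm).bddAbove
    rwa [Set.image_eq_range] at this
  exact le_ciSup hb ⟨x, by simp [hx]⟩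

theorem maxModulus_le {f : ℂ → ℂ} {r B : ℝ} (hr : 0 ≤ r) (h : ∀ x : ℂ, ‖x‖ = r → ‖f x‖ ≤ B) :
    maxModulus f r ≤ B := by
  have : Nonempty (Metric.sphere (0 : ℂ) r) := ⟨⟨(r : ℂ), by simp [abs_of_nonneg hr]⟩⟩
  exact ciSup_le fun x => h x (mem_sphere_zero_iff_norm.1 x.2)

theorem norm_le_of_sphere {f : ℂ → ℂ} (hf : Differentiable ℂ f) {r B : ℝ} (hr : 0 < r)
    (h : ∀ x : ℂ, ‖x‖ = r → ‖f x‖ ≤ B) {x : ℂ} (hx : ‖x‖ ≤ r) : ‖f x‖ ≤ B := by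
  refine Complex.norm_le_of_forall_mem_frontier_norm_le (U := Metric.ball (0 : ℂ) r)
    Metric.isBounded_ball hf.diffContOnCl (fun z hz => h z ?_) ?_
  · rw [frontier_ball _ hr.ne'] at hz
    simpa using hz
  · rw [closure_ball _ hr.ne']
    simpa using hx

theorem norm_le_maxModulus_of_le {f : ℂ → ℂ} (hf : Differentiable ℂ f) {r : ℝ} (hr : 0 < r)
    {x : ℂ} (hx : ‖x‖ ≤ r) : ‖f x‖ ≤ maxModulus f r :=
  norm_le_of_sphere hf hr (fun _ hz => norm_le_maxModulus hf.continuous hz) hx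

theorem maxModulus_mono {f : ℂ → ℂ} (hf : Differentiable ℂ f) {r R : ℝ} (hr : 0 ≤ r)
    (hR : 0 < R) (h : r ≤ R) : maxModulus f r ≤ maxModulus f R :=
  maxModulus_le hr fun _ hx => norm_le_maxModulus_of_le hf hR (hx.le.trans h)

theorem maxModulus_nonneg (f : ℂ → ℂ) (r : ℝ) : 0 ≤ maxModulus f r :=
  Real.iSup_nonneg fun _ => norm_nonneg _

end MaxModulus

/-! ### The basis polynomials and their maxima on circles -/

section Basis

variable {q : ℝ}

/-- The maximum of `φ_n(x; 1)` on the circle of radius `r`. -/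
noncomputable def phiMax (q : ℝ) (n : ℕ) (r : ℝ) : ℝ :=
  ∏ j ∈ Finset.range n, (1 + 2 * r * q ^ j + q ^ (2 * j))

theorem continuous_phi (q : ℝ) (n : ℕ) : Continuous (phi q n) := by
  unfold phi; fun_prop

theorem phi_succ (q : ℝ) (n : ℕ) (x : ℂ) :
    phi q (n + 1) x = phi q n x * (1 - 2 * x * (q : ℂ) ^ n + (q : ℂ) ^ (2 * n)) :=
  Finset.prod_range_succ _ _

theorem norm_phi_le (hq : 0 < q) (n : ℕ) (x : ℂ) : ‖phi q n x‖ ≤ phiMax q n ‖x‖ := by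
  unfold phi phiMax
  rw [norm_prod]
  refine Finset.prod_le_prod (fun _ _ => norm_nonneg _) fun j _ => ?_
  refine (norm_add_le _ _).trans ?_
  refine add_le_add ((norm_sub_le _ _).trans ?_) ?_ <;> simp [abs_of_pos hq]

theorem phi_neg (q : ℝ) (n : ℕ) (r : ℝ) : phi q n (-(r : ℂ)) = (phiMax q n r : ℂ) := by
  unfold phi phiMax
  push_cast
  exact Finset.prod_congr rfl fun j _ => by ring

theorem phiMax_pos (hq : 0 < q) (n : ℕ) {r : ℝ} (hr : 0 ≤ r) : 0 < phiMax q n r :=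
  Finset.prod_pos fun _ _ => by positivity

theorem phiMax_mono (hq : 0 < q) (n : ℕ) {r R : ℝ} (hr : 0 ≤ r) (h : r ≤ R) :
    phiMax q n r ≤ phiMax q n R := by
  unfold phiMax
  gcongr

theorem phiMax_le_pow (hq : 0 < q) (hq1 : q < 1) (n : ℕ) {r : ℝ} (hr : 0 ≤ r) :
    phiMax q n r ≤ (2 + 2 * r) ^ n := by
  unfold phiMax
  refine (Finset.prod_le_prod (g := fun _ => 2 + 2 * r) (fun _ _ => by positivity)
    fun j _ => ?_).trans (by simp)
  have h1 : q ^ j ≤ 1 := pow_le_one₀ hq.le hq1.le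
  have h2 : q ^ (2 * j) ≤ 1 := pow_le_one₀ hq.le hq1.le
  nlinarith

theorem le_phiMax (hq : 0 < q) {n : ℕ} (hn : 1 ≤ n) {r : ℝ} (hr : 0 ≤ r) :
    r ≤ phiMax q n r := by
  obtain ⟨m, rfl⟩ := Nat.exists_eq_add_of_le' hn
  unfold phiMax
  rw [Finset.prod_range_succ']
  have h1 : 1 ≤ ∏ j ∈ Finset.range m, (1 + 2 * r * q ^ (j + 1) + q ^ (2 * (j + 1))) := by
    refine Finset.prod_induction _ (fun y => (1 : ℝ) ≤ y)
      (fun _ _ => one_le_mul_of_one_le_of_one_le) le_rfl fun j _ => ?_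
    have : 0 ≤ 2 * r * q ^ (j + 1) + q ^ (2 * (j + 1)) := by positivity
    linarith
  calc r ≤ 1 * (1 + 2 * r * q ^ 0 + q ^ (2 * 0)) := by simp; linarith
    _ ≤ _ := by gcongr

/-- All zeros of `phi q n` are positive, so its modulus on the circle is largest at `-r`. -/
theorem termSize_eq (hq : 0 < q) (a : ℕ → ℂ) (n : ℕ) {r : ℝ} (hr : 0 ≤ r) :
    termSize q a n r = ‖a n‖ * phiMax q n r := by
  refine le_antisymm (maxModulus_le hr fun x hx => ?_) ?_
  · rw [norm_mul, ← hx]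
    gcongr
    exact norm_phi_le hq n x
  · have h := norm_le_maxModulus (f := fun x => a n * phi q n x)
      (continuous_const.mul (continuous_phi q n)) (r := r) (x := -(r : ℂ))
      (by simp [abs_of_nonneg hr])
    rw [phi_neg] at h
    rw [norm_mul, Complex.norm_real, Real.norm_of_nonneg (phiMax_pos hq n hr).le] at h
    exact h

theorem termSize_nonneg (q : ℝ) (a : ℕ → ℂ) (n : ℕ) (r : ℝ) : 0 ≤ termSize q a n r :=
  maxModulus_nonneg _ _

end Basis

/-! ### Newton interpolation at the nodes -/

section Newton

variable {q : ℝ}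

/-- The zero `(q ^ n + q ^ (-n)) / 2` of the `n`-th factor of the basis polynomials. -/
noncomputable def node (q : ℝ) (n : ℕ) : ℝ := (q ^ n + (q ^ n)⁻¹) / 2

theorem factor_eq (hq : 0 < q) (n : ℕ) (x : ℂ) :
    1 - 2 * x * (q : ℂ) ^ n + (q : ℂ) ^ (2 * n) = -(2 * (q : ℂ) ^ n) * (x - node q n) := by
  have : (q : ℂ) ^ n ≠ 0 := pow_ne_zero _ (by exact_mod_cast hq.ne')
  unfold node
  push_cast
  field_simp
  ring

theorem node_strictMono (hq : 0 < q) (hq1 : q < 1) : StrictMono (node q) := by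
  refine strictMono_nat_of_lt_succ fun n => ?_
  have hn : 0 < q ^ n := pow_pos hq n
  have h1 : q ^ n ≤ 1 := pow_le_one₀ hq.le hq1.le
  unfold node
  rw [pow_succ]
  have key : q ^ n * q + (q ^ n * q)⁻¹ - (q ^ n + (q ^ n)⁻¹)
      = (1 - q) * (1 - q ^ n * q ^ n * q) / (q ^ n * q) := by
    field_simp
    ring
  have h2 : q ^ n * q ^ n * q < 1 :=
    (mul_le_of_le_one_left hq.le (mul_le_one₀ h1 hn.le h1)).trans_lt hq1
  have : 0 < (1 - q) * (1 - q ^ n * q ^ n * q) / (q ^ n * q) :=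
    div_pos (mul_pos (by linarith) (by linarith)) (by positivity)
  linarith

theorem node_le (hq : 0 < q) (hq1 : q < 1) (n : ℕ) : node q n ≤ (q ^ n)⁻¹ := by
  have hn : 0 < q ^ n := pow_pos hq n
  have h1 : q ^ n ≤ 1 := pow_le_one₀ hq.le hq1.le
  have := (one_le_inv₀ hn).2 h1
  unfold node
  linarith

theorem node_pos (hq : 0 < q) (n : ℕ) : 0 < node q n := by
  unfold node; positivity

theorem phi_node_eq_zero (hq : 0 < q) {j k : ℕ} (h : j < k) : phi q k (node q j) = 0 :=
  Finset.prod_eq_zero (Finset.mem_range.2 h) (by rw [factor_eq hq]; simp)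

theorem phi_node_ne_zero (hq : 0 < q) (hq1 : q < 1) (k : ℕ) : phi q k (node q k) ≠ 0 := by
  refine Finset.prod_ne_zero_iff.2 fun j hj => ?_
  rw [factor_eq hq]
  have h1 : (q : ℂ) ^ j ≠ 0 := pow_ne_zero _ (by exact_mod_cast hq.ne')
  have h2 := node_strictMono hq hq1 (Finset.mem_range.1 hj)
  refine mul_ne_zero (by simpa using h1) (sub_ne_zero.2 ?_)
  exact_mod_cast h2.ne'

/-- An Askey-Wilson expansion is determined by its values at the nodes. -/
theorem IsExpansion.unique (hq : 0 < q) (hq1 : q < 1) {f : ℂ → ℂ} {a b : ℕ → ℂ}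
    (ha : IsExpansion q f a) (hb : IsExpansion q f b) : a = b := by
  -- At node `k` every term of index above `k` vanishes, so the coefficients solve a triangular
  -- system.
  have key : ∀ {c : ℕ → ℂ}, IsExpansion q f c → ∀ k,
      f (node q k) = ∑ j ∈ Finset.range k, c j * phi q j (node q k)
        + c k * phi q k (node q k) := by
    intro c hc k
    have h1 := (hc {(node q k : ℂ)} isCompact_singleton).tendsto_at (Set.mem_singleton _)
    refine tendsto_nhds_unique h1 (tendsto_const_nhds.congr' ?_)
    filter_upwards [eventually_ge_atTop (k + 1)] with n hn
    rw [← Finset.sum_range_succ (fun j => c j * phi q j (node q k))]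
    refine Finset.sum_subset (Finset.range_mono hn) fun j _ hj => ?_
    rw [phi_node_eq_zero hq (by simpa using hj), mul_zero]
  funext k
  induction k using Nat.strong_induction_on with
  | _ k ih =>
    have h := (key ha k).symm.trans (key hb k)
    rw [Finset.sum_congr rfl fun j hj => by rw [ih j (Finset.mem_range.1 hj)]] at h
    exact mul_right_cancel₀ (phi_node_ne_zero hq hq1 k) (add_left_cancel h)

/-- The remainders of Newton interpolation of `f` at the nodes. -/
noncomputable def newtonRem (q : ℝ) (f : ℂ → ℂ) : ℕ → ℂ → ℂ
  | 0 => f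
  | n + 1 => fun x => dslope (newtonRem q f n) (node q n) x * (-(2 * (q : ℂ) ^ n))⁻¹

/-- The Newton interpolation coefficients of `f` at the nodes. -/
noncomputable def newtonCoeff (q : ℝ) (f : ℂ → ℂ) (n : ℕ) : ℂ := newtonRem q f n (node q n)

theorem differentiable_newtonRem {f : ℂ → ℂ} (hf : Differentiable ℂ f) (n : ℕ) :
    Differentiable ℂ (newtonRem q f n) := by
  induction n with
  | zero => exact hf
  | succ n ih =>
    refine Differentiable.mul_const ?_ _
    rw [← differentiableOn_univ] at ih ⊢
    exact (Complex.differentiableOn_dslope univ_mem).2 ih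

theorem newtonRem_eq (hq : 0 < q) (f : ℂ → ℂ) (n : ℕ) (x : ℂ) :
    newtonRem q f n x = newtonCoeff q f n
      + (1 - 2 * x * (q : ℂ) ^ n + (q : ℂ) ^ (2 * n)) * newtonRem q f (n + 1) x := by
  have h1 : (q : ℂ) ^ n ≠ 0 := pow_ne_zero _ (by exact_mod_cast hq.ne')
  have h := sub_smul_dslope (newtonRem q f n) (node q n : ℂ) x
  rw [smul_eq_mul] at h
  rw [factor_eq hq, newtonRem, newtonCoeff]
  field_simp
  linear_combination -h

theorem eq_sum_add_newtonRem (hq : 0 < q) (f : ℂ → ℂ) (n : ℕ) (x : ℂ) :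
    f x = ∑ k ∈ Finset.range n, newtonCoeff q f k * phi q k x
      + phi q n x * newtonRem q f n x := by
  induction n with
  | zero => simp [phi, newtonRem]
  | succ n ih =>
    rw [Finset.sum_range_succ, phi_succ]
    have := newtonRem_eq hq f n x
    linear_combination ih + phi q n x * this

theorem norm_factor_ge (hq : 0 < q) (j : ℕ) {R : ℝ} {x : ℂ} (hx : ‖x‖ = R) :
    2 * R * q ^ j - 1 - q ^ (2 * j) ≤ ‖1 - 2 * x * (q : ℂ) ^ j + (q : ℂ) ^ (2 * j)‖ := by
  have h1 : ‖2 * x * (q : ℂ) ^ j‖ = 2 * R * q ^ j := by simp [hx, abs_of_pos hq]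
  have h2 : ‖1 + (q : ℂ) ^ (2 * j)‖ ≤ 1 + q ^ (2 * j) :=
    (norm_add_le _ _).trans (by simp [abs_of_pos hq])
  have h3 := norm_sub_norm_le (2 * x * (q : ℂ) ^ j) (1 + (q : ℂ) ^ (2 * j))
  rw [norm_sub_rev, h1] at h3
  have h4 : 1 + (q : ℂ) ^ (2 * j) - 2 * x * (q : ℂ) ^ j
    = 1 - 2 * x * (q : ℂ) ^ j + (q : ℂ) ^ (2 * j) := by ring
  rw [h4] at h3
  linarith

theorem factor_lower_nonneg (hq : 0 < q) {j : ℕ} {R : ℝ} (hR : node q j ≤ R) :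
    0 ≤ 2 * R * q ^ j - 1 - q ^ (2 * j) := by
  have hj : 0 < q ^ j := pow_pos hq j
  have h : 2 * node q j * q ^ j = q ^ (2 * j) + 1 := by
    unfold node
    field_simp
    ring
  nlinarith

/-- The interpolation remainder is bounded on a disc that contains the nodes. -/
theorem norm_newtonRem_mul_prod_le (hq : 0 < q) (hq1 : q < 1) {f : ℂ → ℂ}
    (hf : Differentiable ℂ f) (n : ℕ) {R : ℝ} (hR : node q n ≤ R) {x : ℂ} (hx : ‖x‖ ≤ R) :
    ‖newtonRem q f n x‖ * ∏ j ∈ Finset.range n, (2 * R * q ^ j - 1 - q ^ (2 * j))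
      ≤ 2 ^ n * maxModulus f R := by
  have hR0 : 0 < R := (node_pos hq n).trans_le hR
  induction n generalizing x with
  | zero => simpa [newtonRem] using norm_le_maxModulus_of_le hf hR0 hx
  | succ n ih =>
    have hn : node q n ≤ R := (node_strictMono hq hq1 n.lt_succ_self).le.trans hR
    set P := ∏ j ∈ Finset.range n, (2 * R * q ^ j - 1 - q ^ (2 * j)) with hP
    have hP0 : 0 ≤ P := Finset.prod_nonneg fun j hj => factor_lower_nonneg hq
      (((node_strictMono hq hq1).monotone (Finset.mem_range.1 hj).le).trans hn)
    set d := 2 * R * q ^ n - 1 - q ^ (2 * n) with hd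
    have hd0 : 0 ≤ d := factor_lower_nonneg hq hn
    rw [Finset.prod_range_succ]
    have hnode : ‖(node q n : ℂ)‖ ≤ R := by
      simpa [abs_of_pos (node_pos hq n)] using hn
    -- By the maximum principle it is enough to bound on the circle, away from the removable
    -- singularity at the node. Subtracting the value at the node costs a factor 2 per step.
    have key : ‖newtonRem q f (n + 1) x * ((P * d : ℝ) : ℂ)‖ ≤ 2 ^ (n + 1) * maxModulus f R := by
      refine norm_le_of_sphere (f := fun x => newtonRem q f (n + 1) x * ((P * d : ℝ) : ℂ))
        ((differentiable_newtonRem hf (n + 1)).mul_const _) hR0 (fun z hz => ?_) hx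
      have h1 := ih hn hz.le
      have h2 := ih hn hnode
      have h3 := newtonRem_eq hq f n z
      have h4 : ‖newtonRem q f (n + 1) z‖ * d
          ≤ ‖newtonRem q f n z‖ + ‖newtonRem q f n (node q n)‖ := by
        calc ‖newtonRem q f (n + 1) z‖ * d
            ≤ ‖newtonRem q f (n + 1) z‖ * ‖1 - 2 * z * (q : ℂ) ^ n + (q : ℂ) ^ (2 * n)‖ := by
              gcongr
              exact norm_factor_ge hq n hz
          _ = ‖newtonRem q f n z - newtonCoeff q f n‖ := by
              rw [← norm_mul, h3]
              congr 1
              ring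
          _ ≤ _ := norm_sub_le _ _
      rw [norm_mul, Complex.norm_real, Real.norm_of_nonneg (mul_nonneg hP0 hd0)]
      calc ‖newtonRem q f (n + 1) z‖ * (P * d) = (‖newtonRem q f (n + 1) z‖ * d) * P := by ring
        _ ≤ (‖newtonRem q f n z‖ + ‖newtonRem q f n (node q n)‖) * P := by gcongr
        _ ≤ 2 ^ (n + 1) * maxModulus f R := by rw [pow_succ]; linarith
    rwa [norm_mul, Complex.norm_real, Real.norm_of_nonneg (mul_nonneg hP0 hd0)] at key

/-- The shift `2 q^(-n)` of the radius makes each lower bound `2Rq^j - 1 - q^(2j)` at least the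
factor `1 + 2rq^j + q^(2j)` of `phiMax`. -/
theorem termSize_newtonCoeff_le (hq : 0 < q) (hq1 : q < 1) {f : ℂ → ℂ}
    (hf : Differentiable ℂ f) (n : ℕ) {r : ℝ} (hr : 0 ≤ r) :
    termSize q (newtonCoeff q f) n r ≤ 2 ^ n * maxModulus f (r + 2 * (q ^ n)⁻¹) := by
  have hqn : 0 < (q ^ n)⁻¹ := inv_pos.2 (pow_pos hq n)
  have hR : node q n ≤ r + 2 * (q ^ n)⁻¹ := by linarith [node_le hq hq1 n]
  rw [termSize_eq hq _ _ hr]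
  refine le_trans ?_ (norm_newtonRem_mul_prod_le hq hq1 hf n hR (x := node q n) ?_)
  · rw [newtonCoeff]
    unfold phiMax
    gcongr with j hj
    have h1 : 1 ≤ (q ^ n)⁻¹ * q ^ j := by
      rw [inv_mul_eq_div, one_le_div (pow_pos hq n)]
      exact pow_le_pow_of_le_one hq.le hq1.le (Finset.mem_range.1 hj).le
    have h2 : q ^ (2 * j) ≤ 1 := pow_le_one₀ hq.le hq1.le
    nlinarith
  · simpa [abs_of_pos (node_pos hq n)] using hR

/-- The product equals `q^(-n(n+1)/2)`; the linear part of the exponent is discarded. -/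
theorem exp_le_prod_pow (hq : 0 < q) (hq1 : q < 1) (n : ℕ) :
    Real.exp (-Real.log q / 2 * n ^ 2) ≤ ∏ j ∈ Finset.range n, (q ^ n)⁻¹ * q ^ j := by
  have h : ∀ m : ℕ, Real.exp (Real.log q / 2 * m ^ 2) ≤ ∏ j ∈ Finset.range m, q ^ j := by
    intro m
    induction m with
    | zero => simp
    | succ m ih =>
      rw [Finset.prod_range_succ]
      have h1 : q ^ m = Real.exp (Real.log q * m) := by
        rw [mul_comm, Real.exp_nat_mul, Real.exp_log hq]
      have h2 : Real.log q / 2 * ((m + 1 : ℕ) : ℝ) ^ 2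
          = Real.log q / 2 * m ^ 2 + (Real.log q * m + Real.log q / 2) := by
        push_cast; ring
      rw [h2, Real.exp_add]
      gcongr
      rw [h1]
      gcongr
      linarith [Real.log_neg hq hq1]
  rw [Finset.prod_mul_distrib, Finset.prod_const, Finset.card_range]
  have h1 : ((q ^ n)⁻¹) ^ n = Real.exp (-Real.log q * n ^ 2) := by
    rw [← Real.exp_log hq, ← Real.exp_nat_mul, ← Real.exp_neg, ← Real.exp_nat_mul]
    congr 1
    simp; ring
  have h2 : -Real.log q / 2 * (n : ℝ) ^ 2
      = -Real.log q * n ^ 2 + Real.log q / 2 * n ^ 2 := by ring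
  rw [h1, h2, Real.exp_add]
  gcongr
  exact h n

theorem norm_newtonRem_mul_exp_le (hq : 0 < q) (hq1 : q < 1) {f : ℂ → ℂ}
    (hf : Differentiable ℂ f) (n : ℕ) {x : ℂ} (hx : ‖x‖ ≤ 2 * (q ^ n)⁻¹) :
    ‖newtonRem q f n x‖ * Real.exp (-Real.log q / 2 * n ^ 2)
      ≤ maxModulus f (2 * (q ^ n)⁻¹) := by
  have hqn : 0 < (q ^ n)⁻¹ := inv_pos.2 (pow_pos hq n)
  have hR : node q n ≤ 2 * (q ^ n)⁻¹ := by linarith [node_le hq hq1 n]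
  have h := norm_newtonRem_mul_prod_le hq hq1 hf n hR hx
  have h1 : (2 : ℝ) ^ n * Real.exp (-Real.log q / 2 * n ^ 2)
      ≤ ∏ j ∈ Finset.range n, (2 * (2 * (q ^ n)⁻¹) * q ^ j - 1 - q ^ (2 * j)) := by
    calc _ ≤ 2 ^ n * ∏ j ∈ Finset.range n, (q ^ n)⁻¹ * q ^ j := by
          gcongr; exact exp_le_prod_pow hq hq1 n
      _ = ∏ j ∈ Finset.range n, 2 * ((q ^ n)⁻¹ * q ^ j) := by
          rw [Finset.prod_mul_distrib (f := fun _ => (2 : ℝ))]; simp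
      _ ≤ _ := by
        refine Finset.prod_le_prod (fun _ _ => by positivity) fun j hj => ?_
        have h1 : 1 ≤ (q ^ n)⁻¹ * q ^ j := by
          rw [inv_mul_eq_div, one_le_div (pow_pos hq n)]
          exact pow_le_pow_of_le_one hq.le hq1.le (Finset.mem_range.1 hj).le
        have h2 : q ^ (2 * j) ≤ 1 := pow_le_one₀ hq.le hq1.le
        nlinarith
  have h2 := mul_le_mul_of_nonneg_left h1 (norm_nonneg (newtonRem q f n x))
  have h3 : (0 : ℝ) < 2 ^ n := by positivity
  refine le_of_mul_le_mul_left ?_ h3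
  linarith

end Newton

/-! ### Orders of growth in powers of `ln r` -/

section LogLogOrder

open Asymptotics

/-- The growth order `limsup_{r → ∞} ln⁺ u(r) / ln ln r` of `u` relative to powers of `ln r`. -/
noncomputable def powLogOrder (u : ℝ → ℝ) : EReal :=
  limsup (fun r : ℝ => ((Real.posLog (u r) / Real.log (Real.log r) : ℝ) : EReal)) atTop

theorem logOrder_eq (g : ℝ → ℝ) : logOrder g = powLogOrder fun r => Real.posLog (g r) := rfl

theorem eventually_one_lt_log : ∀ᶠ r : ℝ in atTop, 1 < Real.log r :=
  Real.tendsto_log_atTop.eventually_gt_atTop 1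

theorem abs_le_exp_posLog (x : ℝ) : |x| ≤ Real.exp (Real.posLog x) := by
  rcases eq_or_ne x 0 with rfl | hx
  · simp
  · rw [← Real.log_le_iff_le_exp (abs_pos.2 hx), Real.log_abs]
    exact le_max_right _ _

theorem isBigO_of_powLogOrder_lt {u : ℝ → ℝ} {s : ℝ} (h : powLogOrder u < s) :
    u =O[atTop] fun r => Real.log r ^ s := by
  refine IsBigO.of_bound 1 ?_
  filter_upwards [eventually_lt_of_limsup_lt h, eventually_one_lt_log] with r hr hl
  have hl0 : 0 < Real.log r := by linarith
  rw [EReal.coe_lt_coe_iff, div_lt_iff₀ (Real.log_pos hl)] at hr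
  rw [one_mul, Real.norm_eq_abs, Real.norm_of_nonneg (Real.rpow_nonneg hl0.le _),
    Real.rpow_def_of_pos hl0]
  exact (abs_le_exp_posLog _).trans (Real.exp_le_exp.2 (by linarith))

theorem isLittleO_log_rpow {s t : ℝ} (h : s < t) :
    (fun r : ℝ => Real.log r ^ s) =o[atTop] fun r => Real.log r ^ t := by
  have h0 : (fun r : ℝ => r ^ s) =o[atTop] fun r : ℝ => r ^ t := by
    refine isLittleO_of_tendsto' ?_ ?_
    · filter_upwards [eventually_gt_atTop 0] with r hr h0
      exact absurd h0 (Real.rpow_pos_of_pos hr _).ne'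
    · refine (tendsto_rpow_neg_atTop (sub_pos.2 h)).congr' ?_
      filter_upwards [eventually_gt_atTop 0] with r hr
      rw [← Real.rpow_sub hr, neg_sub]
  exact h0.comp_tendsto Real.tendsto_log_atTop

/-- Any larger exponent `z` absorbs the implied constant. -/
theorem powLogOrder_le_of_isBigO {u : ℝ → ℝ} {s : ℝ} (hs : 0 ≤ s)
    (h : u =O[atTop] fun r => Real.log r ^ s) : powLogOrder u ≤ s := by
  refine EReal.le_of_forall_lt_iff_le.1 fun z hz => ?_
  have hz' : s < z := EReal.coe_lt_coe_iff.1 hz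
  refine limsup_le_of_le (by isBoundedDefault) ?_
  filter_upwards [(h.trans_isLittleO (isLittleO_log_rpow hz')).bound one_pos,
    eventually_one_lt_log] with r hr hl
  have hl0 : 0 < Real.log r := by linarith
  rw [EReal.coe_le_coe_iff, div_le_iff₀ (Real.log_pos hl)]
  rw [one_mul, Real.norm_eq_abs, Real.norm_of_nonneg (Real.rpow_nonneg hl0.le _)] at hr
  rw [← Real.posLog_abs]
  refine (Real.posLog_le_posLog (abs_nonneg _) hr).trans ?_
  rw [Real.posLog_eq_log, Real.log_rpow hl0]
  exact (Real.one_le_rpow hl.le (by linarith)).trans (le_abs_self _)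

theorem powLogOrder_le_powLogOrder {u v : ℝ → ℝ} (hv : 1 ≤ powLogOrder v)
    (h : ∀ s : ℝ, 1 < s → (v =O[atTop] fun r => Real.log r ^ s) →
      u =O[atTop] fun r => Real.log r ^ s) : powLogOrder u ≤ powLogOrder v := by
  refine EReal.le_of_forall_lt_iff_le.1 fun s hs => ?_
  have h1 : 1 < s := by exact_mod_cast hv.trans_lt hs
  exact powLogOrder_le_of_isBigO (by linarith) (h s h1 (isBigO_of_powLogOrder_lt hs))

theorem powLogOrder_eq_one_add {u v : ℝ → ℝ} (hu : 1 ≤ powLogOrder u) (hv : 0 ≤ powLogOrder v)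
    (h1 : ∀ s : ℝ, 1 < s → (u =O[atTop] fun r => Real.log r ^ s) →
      v =O[atTop] fun r => Real.log r ^ (s - 1))
    (h2 : ∀ s : ℝ, 1 < s → (v =O[atTop] fun r => Real.log r ^ (s - 1)) →
      u =O[atTop] fun r => Real.log r ^ s) : powLogOrder u = 1 + powLogOrder v := by
  apply le_antisymm
  · refine EReal.le_of_forall_lt_iff_le.1 fun s hs => ?_
    have hs' : powLogOrder v < ((s - 1 : ℝ) : EReal) := by
      rw [EReal.coe_sub, EReal.lt_sub_iff_add_lt (Or.inl (EReal.coe_ne_bot _))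
        (Or.inl (EReal.coe_ne_top _)), add_comm]
      exact hs
    have hs1 : 0 < s - 1 := by exact_mod_cast hv.trans_lt hs'
    exact powLogOrder_le_of_isBigO (by linarith)
      (h2 s (by linarith) (isBigO_of_powLogOrder_lt hs'))
  · refine EReal.le_of_forall_lt_iff_le.1 fun s hs => ?_
    have hs1 : 1 < s := by exact_mod_cast hu.trans_lt hs
    have h := powLogOrder_le_of_isBigO (by linarith) (h1 s hs1 (isBigO_of_powLogOrder_lt hs))
    calc 1 + powLogOrder v ≤ ((1 : ℝ) : EReal) + ((s - 1 : ℝ) : EReal) := by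
          gcongr; exact_mod_cast le_rfl
      _ = s := by rw [← EReal.coe_add]; congr 1; ring

theorem powLogOrder_nonneg (u : ℝ → ℝ) : 0 ≤ powLogOrder u := by
  refine le_limsup_of_frequently_le (Eventually.frequently ?_) (by isBoundedDefault)
  filter_upwards [eventually_one_lt_log] with r hr
  exact_mod_cast div_nonneg Real.posLog_nonneg (Real.log_pos hr).le

theorem one_le_powLogOrder {u : ℝ → ℝ} (h : Real.log =O[atTop] u) : 1 ≤ powLogOrder u := by
  by_contra! hlt
  obtain ⟨s, hs, hs1⟩ := EReal.exists_between_coe_real hlt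
  have h1 : s < 1 := by exact_mod_cast hs1
  have h2 := (h.trans (isBigO_of_powLogOrder_lt hs)).trans_isLittleO (isLittleO_log_rpow h1)
  simp only [Real.rpow_one] at h2
  refine isLittleO_irrefl ?_ h2
  exact (eventually_one_lt_log.mono fun r hr => by linarith).frequently

/-- A function that dominates a linear function has log-order at least one. -/
theorem one_le_logOrder {g : ℝ → ℝ} {κ c : ℝ} (hκ : 0 < κ)
    (h : ∀ᶠ r in atTop, κ * (r - c) ≤ g r) : 1 ≤ logOrder g := by
  refine one_le_powLogOrder (IsBigO.of_bound 2 ?_)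
  -- These thresholds give `r - c ≥ r/2` and `κ √r ≥ 2`, hence `κ (r - c) ≥ √r`.
  filter_upwards [h, eventually_one_lt_log, eventually_ge_atTop (2 * c), eventually_ge_atTop 1,
    eventually_ge_atTop ((2 / κ) ^ 2)] with r hr hl hc h1 hκr
  have hs : 2 / κ ≤ √r := Real.le_sqrt_of_sq_le hκr
  rw [div_le_iff₀ hκ] at hs
  have hs1 : 1 ≤ √r := Real.one_le_sqrt.2 h1
  have hsq := Real.sq_sqrt (zero_le_one.trans h1)
  have hle : √r ≤ g r := by
    refine le_trans ?_ hr
    nlinarith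
  have h2 : Real.log r / 2 ≤ Real.posLog (g r) := by
    rw [← Real.log_sqrt (by linarith)]
    exact (Real.log_le_log (by linarith) hle).trans (le_max_right _ _)
  rw [Real.norm_of_nonneg (by linarith), Real.norm_of_nonneg Real.posLog_nonneg]
  linarith

theorem isBigO_log_rpow_comp_rpow {u : ℝ → ℝ} {s B : ℝ} (hB : 0 < B)
    (h : u =O[atTop] fun r => Real.log r ^ s) :
    (fun r => u (r ^ B)) =O[atTop] fun r => Real.log r ^ s := by
  refine (h.comp_tendsto (tendsto_rpow_atTop hB)).trans ?_
  refine IsBigO.of_bound (B ^ s) ?_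
  filter_upwards [eventually_one_lt_log, eventually_gt_atTop 0] with r hr h0
  have hl : 0 ≤ Real.log r := by linarith
  simp only [Function.comp_apply]
  rw [Real.log_rpow h0, Real.mul_rpow hB.le hl, norm_mul,
    Real.norm_of_nonneg (Real.rpow_nonneg hB.le _)]

theorem isBigO_log_log_rpow {s : ℝ} (hs : 1 ≤ s) :
    Real.log =O[atTop] fun r => Real.log r ^ s := by
  refine IsBigO.of_bound 1 ?_
  filter_upwards [eventually_one_lt_log] with r hr
  rw [one_mul, Real.norm_of_nonneg (by linarith),
    Real.norm_of_nonneg (Real.rpow_nonneg (by linarith) _)]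
  exact Real.self_le_rpow_of_one_le hr.le hs

end LogLogOrder

/-! ### Gaussian decay of the remainders and convergence -/

section Expansion

open Asymptotics

variable {q : ℝ}

theorem pow_mul_exp_le_one {b c : ℝ} (hb : 0 ≤ b) {n : ℕ} (h : b ≤ Real.exp (c * n)) :
    b ^ n * Real.exp (-c * n ^ 2) ≤ 1 := by
  calc b ^ n * Real.exp (-c * n ^ 2)
      ≤ Real.exp (c * n) ^ n * Real.exp (-c * n ^ 2) := by gcongr
    _ = 1 := by
      rw [← Real.exp_nat_mul, ← Real.exp_add, Real.exp_eq_one_iff]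
      ring

theorem tendsto_pow_mul_exp {b c : ℝ} (hb : 0 ≤ b) (hc : 0 < c) :
    Tendsto (fun n : ℕ => b ^ n * Real.exp (-c * n ^ 2)) atTop (𝓝 0) := by
  have h1 : Tendsto (fun n : ℕ => Real.exp (c * n)) atTop atTop :=
    Real.tendsto_exp_atTop.comp (tendsto_natCast_atTop_atTop.const_mul_atTop hc)
  refine squeeze_zero' (Eventually.of_forall fun n => by positivity) ?_
    (tendsto_pow_atTop_nhds_zero_of_lt_one (r := (1 / 2 : ℝ)) (by norm_num) (by norm_num))
  -- Applying the bound to `2b` instead of `b` leaves the geometric factor `2^(-n)`.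
  filter_upwards [h1.eventually_ge_atTop (2 * b)] with n hn
  have h := pow_mul_exp_le_one (by positivity) hn
  rw [mul_pow, mul_assoc] at h
  rw [one_div, inv_pow, ← one_div, le_div_iff₀ (by positivity)]
  linarith

theorem tendsto_inv_pow_atTop (hq : 0 < q) (hq1 : q < 1) :
    Tendsto (fun n : ℕ => 2 * (q ^ n)⁻¹) atTop atTop := by
  simp_rw [← inv_pow]
  exact (tendsto_pow_atTop_atTop_of_one_lt ((one_lt_inv₀ hq).2 hq1)).const_mul_atTop two_pos

/-- If the log-order of `f` is below two, the interpolation remainders decay like a Gaussian. -/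
theorem exists_norm_newtonRem_le (hq : 0 < q) (hq1 : q < 1) {f : ℂ → ℂ}
    (hf : Differentiable ℂ f) (hσ : logOrder (maxModulus f) < 2) :
    ∃ c > 0, ∃ C > 0, ∀ (n : ℕ) (x : ℂ), ‖x‖ ≤ 2 * (q ^ n)⁻¹ →
      ‖newtonRem q f n x‖ ≤ C * Real.exp (-c * n ^ 2) := by
  obtain ⟨s, hs, hs2⟩ := EReal.exists_between_coe_real hσ
  have hs2' : s < 2 := EReal.coe_lt_coe_iff.1 hs2
  have hlq := Real.log_neg hq hq1
  have h1 := (isBigO_of_powLogOrder_lt (logOrder_eq _ ▸ hs)).trans_isLittleO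
    (isLittleO_log_rpow hs2')
  have h2 := h1.comp_tendsto (tendsto_inv_pow_atTop hq hq1)
  have h3 : (fun n : ℕ => Real.log (2 * (q ^ n)⁻¹)) =O[atTop] fun n : ℕ => (n : ℝ) := by
    refine IsBigO.of_bound (Real.log 2 + -Real.log q) ?_
    filter_upwards [eventually_ge_atTop 1] with n hn
    have hn' : (1 : ℝ) ≤ n := by exact_mod_cast hn
    have h0 : 0 < Real.log 2 := Real.log_pos one_lt_two
    rw [Real.log_mul two_ne_zero (inv_ne_zero (pow_ne_zero _ hq.ne')), Real.log_inv,
      Real.log_pow, Real.norm_natCast, Real.norm_of_nonneg (by nlinarith)]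
    nlinarith
  have h4 : (fun n : ℕ => Real.posLog (maxModulus f (2 * (q ^ n)⁻¹)))
      =o[atTop] fun n : ℕ => (n : ℝ) ^ 2 := by
    refine IsLittleO.trans_isBigO ?_ (h3.pow 2)
    simpa [Function.comp_def] using h2
  -- Half of the available rate `-ln q / 2` is spent on absorbing `M(2 q^(-n))`.
  set c := -Real.log q / 4 with hc
  have hc0 : 0 < c := by rw [hc]; linarith
  have h5 : ∀ᶠ n : ℕ in atTop,
      maxModulus f (2 * (q ^ n)⁻¹) * Real.exp (-c * n ^ 2) ≤ 1 := by
    filter_upwards [h4.bound hc0] with n hn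
    rw [Real.norm_of_nonneg Real.posLog_nonneg, Real.norm_of_nonneg (by positivity)] at hn
    have h6 : maxModulus f (2 * (q ^ n)⁻¹) ≤ Real.exp (c * n ^ 2) :=
      (le_abs_self _).trans ((abs_le_exp_posLog _).trans (Real.exp_le_exp.2 hn))
    calc _ ≤ Real.exp (c * n ^ 2) * Real.exp (-c * n ^ 2) := by gcongr
      _ = 1 := by rw [← Real.exp_add, Real.exp_eq_one_iff]; ring
  obtain ⟨C, hC⟩ := Filter.IsBoundedUnder.bddAbove_range
    (f := fun n : ℕ => maxModulus f (2 * (q ^ n)⁻¹) * Real.exp (-c * n ^ 2))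
    ⟨1, eventually_map.2 h5⟩
  refine ⟨c, hc0, max C 1, by positivity, fun n x hx => ?_⟩
  have h6 := norm_newtonRem_mul_exp_le hq hq1 hf n hx
  have h7 : maxModulus f (2 * (q ^ n)⁻¹) * Real.exp (-c * n ^ 2) ≤ max C 1 :=
    (hC ⟨n, rfl⟩).trans (le_max_left _ _)
  have h8 : Real.exp (-Real.log q / 2 * n ^ 2) = Real.exp (c * n ^ 2) * Real.exp (c * n ^ 2) := by
    rw [← Real.exp_add, hc]; congr 1; ring
  have h9 : Real.exp (-c * n ^ 2) = (Real.exp (c * n ^ 2))⁻¹ := by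
    rw [← Real.exp_neg]; congr 1; ring
  rw [h9, ← div_eq_mul_inv] at h7 ⊢
  rw [h8, ← mul_assoc] at h6
  have he := Real.exp_pos (c * (n : ℝ) ^ 2)
  rw [le_div_iff₀ he]
  exact ((le_div_iff₀ he).2 h6).trans h7

theorem isExpansion_newtonCoeff (hq : 0 < q) (hq1 : q < 1) {f : ℂ → ℂ} {c C : ℝ} (hc : 0 < c)
    (h : ∀ (n : ℕ) (x : ℂ), ‖x‖ ≤ 2 * (q ^ n)⁻¹ →
      ‖newtonRem q f n x‖ ≤ C * Real.exp (-c * n ^ 2)) :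
    IsExpansion q f (newtonCoeff q f) := by
  intro K hK
  obtain ⟨ρ, hρ0, hρ⟩ := hK.isBounded.subset_closedBall_lt 0 0
  rw [Metric.tendstoUniformlyOn_iff]
  intro ε hε
  have h1 := (tendsto_pow_mul_exp (b := 2 + 2 * ρ) (by positivity) hc).const_mul C
  rw [mul_zero] at h1
  filter_upwards [h1.eventually_lt_const hε,
    (tendsto_inv_pow_atTop hq hq1).eventually_ge_atTop ρ] with n hn hn' x hx
  have hx' : ‖x‖ ≤ ρ := by simpa using hρ hx
  rw [dist_eq_norm, eq_sum_add_newtonRem hq f n x, add_sub_cancel_left, norm_mul]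
  refine lt_of_le_of_lt ?_ hn
  calc ‖phi q n x‖ * ‖newtonRem q f n x‖
      ≤ (2 + 2 * ρ) ^ n * (C * Real.exp (-c * n ^ 2)) := by
        gcongr
        · exact ((norm_phi_le hq n x).trans (phiMax_mono hq n (norm_nonneg _) hx')).trans
            (phiMax_le_pow hq hq1 n hρ0.le)
        · exact h n x (hx'.trans hn')
    _ = _ := by ring

theorem norm_newtonCoeff_le (hq : 0 < q) (hq1 : q < 1) {f : ℂ → ℂ} {c C : ℝ}
    (h : ∀ (n : ℕ) (x : ℂ), ‖x‖ ≤ 2 * (q ^ n)⁻¹ →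
      ‖newtonRem q f n x‖ ≤ C * Real.exp (-c * n ^ 2)) (n : ℕ) :
    ‖newtonCoeff q f n‖ ≤ C * Real.exp (-c * n ^ 2) := by
  refine h n _ ?_
  have hqn : 0 < (q ^ n)⁻¹ := inv_pos.2 (pow_pos hq n)
  rw [Complex.norm_real, Real.norm_of_nonneg (node_pos hq n).le]
  linarith [node_le hq hq1 n]

end Expansion

/-! ### Existence of the maximal term and the central index -/

section MaximalTerm

variable {q : ℝ} {a : ℕ → ℂ} {c C : ℝ}

theorem termSize_le (hq : 0 < q) (hq1 : q < 1)
    (ha : ∀ n : ℕ, ‖a n‖ ≤ C * Real.exp (-c * n ^ 2)) (n : ℕ) {r : ℝ} (hr : 0 ≤ r) :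
    termSize q a n r ≤ C * ((2 + 2 * r) ^ n * Real.exp (-c * n ^ 2)) := by
  rw [termSize_eq hq a n hr]
  calc ‖a n‖ * phiMax q n r ≤ (C * Real.exp (-c * n ^ 2)) * (2 + 2 * r) ^ n := by
        gcongr
        · exact (phiMax_pos hq n hr).le
        · exact (norm_nonneg _).trans (ha n)
        · exact ha n
        · exact phiMax_le_pow hq hq1 n hr
    _ = _ := by ring

theorem tendsto_termSize (hq : 0 < q) (hq1 : q < 1) (hc : 0 < c)
    (ha : ∀ n : ℕ, ‖a n‖ ≤ C * Real.exp (-c * n ^ 2)) {r : ℝ} (hr : 0 ≤ r) :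
    Tendsto (fun n => termSize q a n r) atTop (𝓝 0) := by
  have h1 := (tendsto_pow_mul_exp (b := 2 + 2 * r) (by positivity) hc).const_mul C
  rw [mul_zero] at h1
  exact squeeze_zero (fun n => termSize_nonneg q a n r)
    (fun n => termSize_le hq hq1 ha n hr) h1

theorem termSize_le_maximalTerm {r : ℝ} (h : Tendsto (fun n => termSize q a n r) atTop (𝓝 0))
    (n : ℕ) : termSize q a n r ≤ maximalTerm q a r :=
  le_ciSup (f := fun n => termSize q a n r) h.bddAbove_range n

/-- Only finitely many terms are as large as a given positive one, so the supremum is attained, and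
at finitely many indices. -/
theorem maximalTerm_spec {r : ℝ} (h : Tendsto (fun n => termSize q a n r) atTop (𝓝 0)) {n₀ : ℕ}
    (h₀ : 0 < termSize q a n₀ r) :
    0 < maximalTerm q a r ∧
    IsGreatest (Set.range fun n : ℕ => termSize q a n r) (maximalTerm q a r) ∧
    IsGreatest {n : ℕ | termSize q a n r = maximalTerm q a r} (centralIndex q a r) := by
  have hfin : {n : ℕ | termSize q a n₀ r ≤ termSize q a n r}.Finite := by
    have := h.eventually_lt_const h₀
    rw [← Nat.cofinite_eq_atTop, Filter.eventually_cofinite] at this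
    simpa using this
  have hle := termSize_le_maximalTerm h
  obtain ⟨m, hm, hmax⟩ := Set.exists_max_image _ (fun n => termSize q a n r) hfin
    ⟨n₀, le_refl (termSize q a n₀ r)⟩
  have hm' : termSize q a n₀ r ≤ termSize q a m r := hm
  have heq : termSize q a m r = maximalTerm q a r := by
    refine le_antisymm (hle m) (ciSup_le fun n => ?_)
    rcases le_total (termSize q a n₀ r) (termSize q a n r) with hn | hn
    · exact hmax n hn
    · exact hn.trans hm'
  have hbdd : BddAbove {n : ℕ | termSize q a n r = maximalTerm q a r} :=
    (hfin.subset fun n (hn : _ = _) => (hle n₀).trans hn.ge).bddAbove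
  refine ⟨h₀.trans_le (hle n₀), ⟨⟨m, heq⟩, ?_⟩, Nat.sSup_mem ⟨m, heq⟩ hbdd,
    fun n hn => le_csSup hbdd hn⟩
  rintro _ ⟨n, rfl⟩
  exact hle n

theorem mul_le_termSize (hq : 0 < q) {n : ℕ} (hn : 1 ≤ n) {r : ℝ} (hr : 0 ≤ r) :
    ‖a n‖ * r ≤ termSize q a n r := by
  rw [termSize_eq hq a n hr]
  gcongr
  exact le_phiMax hq hn hr

theorem two_add_two_mul_le {r : ℝ} (hr : 3 ≤ r) : 2 + 2 * r ≤ Real.exp (2 * Real.log r) := by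
  have h : Real.exp (2 * Real.log r) = r ^ 2 := by
    rw [mul_comm, Real.exp_mul, Real.exp_log (by linarith)]
    norm_num
  rw [h]
  nlinarith

theorem pow_mul_exp_le_one_of_log_le (hc : 0 < c) {r : ℝ} (hr : 3 ≤ r) {n : ℕ}
    (hn : 2 / c * Real.log r ≤ n) : (2 + 2 * r) ^ n * Real.exp (-c * n ^ 2) ≤ 1 := by
  refine pow_mul_exp_le_one (by linarith) ((two_add_two_mul_le hr).trans (Real.exp_le_exp.2 ?_))
  have := mul_le_mul_of_nonneg_left hn hc.le
  calc 2 * Real.log r = c * (2 / c * Real.log r) := by field_simp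
    _ ≤ _ := this

end MaximalTerm

/-! ### Comparison of maximum modulus, maximal term and central index -/

section Growth

open Asymptotics

variable {q : ℝ} {f : ℂ → ℂ} {a : ℕ → ℂ} {c C A κ s : ℝ}

theorem termSize_mono (hq : 0 < q) (a : ℕ → ℂ) (n : ℕ) {r R : ℝ} (hr : 0 ≤ r) (h : r ≤ R) :
    termSize q a n r ≤ termSize q a n R := by
  rw [termSize_eq hq a n hr, termSize_eq hq a n (hr.trans h)]
  gcongr
  exact phiMax_mono hq n hr h

theorem inv_pow_le_rpow (hq : 0 < q) (hq1 : q < 1) {r : ℝ} (hr : 1 ≤ r) {n : ℕ}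
    (hn : n ≤ A * Real.log r) : (q ^ n)⁻¹ ≤ r ^ (A * -Real.log q) := by
  have h1 : (q ^ n)⁻¹ = Real.exp (-Real.log q * n) := by
    rw [neg_mul, Real.exp_neg, mul_comm, Real.exp_nat_mul, Real.exp_log hq]
  rw [h1, Real.rpow_def_of_pos (by linarith)]
  refine Real.exp_le_exp.2 ?_
  have := mul_le_mul_of_nonneg_left hn (neg_nonneg.2 (Real.log_neg hq hq1).le)
  linarith

/-- The central index grows at most logarithmically. -/
theorem eventually_centralIndex_le (hq : 0 < q) (hq1 : q < 1) (hc : 0 < c) (hC : 0 < C)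
    (ha : ∀ n : ℕ, ‖a n‖ ≤ C * Real.exp (-c * n ^ 2))
    (hν : ∀ r : ℝ, 0 < r → termSize q a (centralIndex q a r) r = maximalTerm q a r)
    (hμ : ∀ B : ℝ, ∀ᶠ r in atTop, B < maximalTerm q a r) :
    ∀ᶠ r in atTop, (centralIndex q a r : ℝ) ≤ 2 / c * Real.log r := by
  filter_upwards [hμ C, eventually_ge_atTop 3] with r h1 h3
  -- Beyond this index the Gaussian bounds every term by `C`, whereas the maximal term exceeds `C`.
  by_contra! hlt
  have h2 := termSize_le hq hq1 ha (centralIndex q a r) (by linarith : 0 ≤ r)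
  rw [hν r (by linarith)] at h2
  have h4 := mul_le_mul_of_nonneg_left (pow_mul_exp_le_one_of_log_le hc h3 hlt.le) hC.le
  linarith

theorem isBigO_posLog_maxModulus (hq : 0 < q) (hq1 : q < 1) (hc : 0 < c) (hC : 0 < C)
    (h : ∀ (n : ℕ) (x : ℂ), ‖x‖ ≤ 2 * (q ^ n)⁻¹ →
      ‖newtonRem q f n x‖ ≤ C * Real.exp (-c * n ^ 2))
    (hle : ∀ r : ℝ, 0 < r → ∀ n,
      termSize q (newtonCoeff q f) n r ≤ maximalTerm q (newtonCoeff q f) r)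
    (hμ : ∀ B : ℝ, ∀ᶠ r in atTop, B < maximalTerm q (newtonCoeff q f) r) (hs : 1 ≤ s)
    (hO : (fun r => Real.posLog (maximalTerm q (newtonCoeff q f) r))
      =O[atTop] fun r => Real.log r ^ s) :
    (fun r => Real.posLog (maxModulus f r)) =O[atTop] fun r => Real.log r ^ s := by
  have hL : 0 < -Real.log q := neg_pos.2 (Real.log_neg hq hq1)
  -- For `n ≥ A ln r`, the first entry makes the remainder at most `C`; the second gives `r ≤
  -- q^(-n)`, placing the circle inside the disc of the remainder bound.
  set A := max (2 / c) (1 / -Real.log q) with hA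
  have hA0 : 0 < A := (div_pos two_pos hc).trans_le (le_max_left _ _)
  refine IsBigO.trans ?_ ((isBigO_log_log_rpow hs).add hO)
  refine IsBigO.of_bound 1 ?_
  have hlin : ∀ᶠ r : ℝ in atTop, A * Real.log r + (1 + C) ≤ r := by
    filter_upwards [Real.isLittleO_log_id_atTop.bound (inv_pos.2 (mul_pos two_pos hA0)),
      eventually_one_lt_log, eventually_ge_atTop (2 * (1 + C)), eventually_ge_atTop 0]
      with r h1 h2 h3 h4
    rw [Real.norm_of_nonneg (by linarith), id, Real.norm_of_nonneg h4, inv_mul_eq_div,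
      le_div_iff₀ (by positivity)] at h1
    linarith
  filter_upwards [hlin, hμ 1, eventually_one_lt_log, eventually_ge_atTop 3] with r h1 h2 h3 h4
  have hr0 : 0 < r := by linarith
  set μ := maximalTerm q (newtonCoeff q f) r
  have hM : maxModulus f r ≤ r * μ := by
    set n := ⌈A * Real.log r⌉₊ with hn
    have hn1 : A * Real.log r ≤ n := Nat.le_ceil _
    have hn2 : (n : ℝ) < A * Real.log r + 1 := Nat.ceil_lt_add_one (by nlinarith)
    refine maxModulus_le hr0.le fun x hx => ?_
    have hxR : ‖x‖ ≤ 2 * (q ^ n)⁻¹ := by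
      have h5 : Real.log r ≤ -Real.log q * n := by
        have h6 : 1 / -Real.log q * Real.log r ≤ n :=
          (mul_le_mul_of_nonneg_right (le_max_right _ _) (by linarith)).trans hn1
        rw [one_div, inv_mul_eq_div, div_le_iff₀ hL] at h6
        linarith
      have h7 : (q ^ n)⁻¹ = Real.exp (-Real.log q * n) := by
        rw [neg_mul, Real.exp_neg, mul_comm, Real.exp_nat_mul, Real.exp_log hq]
      have h8 : r ≤ (q ^ n)⁻¹ := by
        rw [h7, ← Real.log_le_iff_le_exp hr0]
        exact h5
      rw [hx]
      linarith
    rw [eq_sum_add_newtonRem hq f n x]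
    have hsum : ‖∑ k ∈ Finset.range n, newtonCoeff q f k * phi q k x‖ ≤ n * μ := by
      refine (norm_sum_le_of_le (Finset.range n) (f := fun k => newtonCoeff q f k * phi q k x)
        (n := fun _ => μ) fun k _ => ?_).trans (by simp)
      refine le_trans ?_ (hle r hr0 k)
      exact norm_le_maxModulus (f := fun x => newtonCoeff q f k * phi q k x)
        (continuous_const.mul (continuous_phi q k)) hx
    have hrem : ‖phi q n x * newtonRem q f n x‖ ≤ C := by
      rw [norm_mul]
      calc ‖phi q n x‖ * ‖newtonRem q f n x‖
          ≤ (2 + 2 * r) ^ n * (C * Real.exp (-c * n ^ 2)) := by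
            gcongr
            · rw [← hx]
              exact (norm_phi_le hq n x).trans (phiMax_le_pow hq hq1 n (norm_nonneg _))
            · exact h n x hxR
        _ = C * ((2 + 2 * r) ^ n * Real.exp (-c * n ^ 2)) := by ring
        _ ≤ C * 1 := by
            gcongr
            refine pow_mul_exp_le_one_of_log_le hc h4 (le_trans ?_ hn1)
            gcongr
            exact le_max_left _ _
        _ = C := mul_one C
    calc _ ≤ n * μ + C := (norm_add_le _ _).trans (add_le_add hsum hrem)
      _ ≤ (A * Real.log r + 1) * μ + C * μ := by
          gcongr
          exact le_mul_of_one_le_right hC.le h2.le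
      _ = (A * Real.log r + (1 + C)) * μ := by ring
      _ ≤ r * μ := by gcongr
  have h5 := (Real.posLog_le_posLog (maxModulus_nonneg f r) hM).trans Real.posLog_mul
  rw [Real.posLog_eq_log (x := r) (by rw [abs_of_pos hr0]; linarith)] at h5
  rw [Real.norm_of_nonneg Real.posLog_nonneg, one_mul]
  exact h5.trans (le_abs_self _)

theorem isBigO_posLog_maximalTerm (hq : 0 < q) (hq1 : q < 1) (hf : Differentiable ℂ f)
    (hA : 0 < A)
    (hν : ∀ r : ℝ, 0 < r → termSize q a (centralIndex q a r) r = maximalTerm q a r)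
    (hA' : ∀ᶠ r in atTop, (centralIndex q a r : ℝ) ≤ A * Real.log r)
    (hterm : ∀ (n : ℕ) (r : ℝ), 0 ≤ r →
      termSize q a n r ≤ 2 ^ n * maxModulus f (r + 2 * (q ^ n)⁻¹))
    (hs : 1 ≤ s)
    (hO : (fun r => Real.posLog (maxModulus f r)) =O[atTop] fun r => Real.log r ^ s) :
    (fun r => Real.posLog (maximalTerm q a r)) =O[atTop] fun r => Real.log r ^ s := by
  have hL : 0 < -Real.log q := neg_pos.2 (Real.log_neg hq hq1)
  have hB : 0 < A * -Real.log q + 2 := by positivity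
  refine IsBigO.trans ?_ (((isBigO_log_log_rpow hs).const_mul_left A).add
    (isBigO_log_rpow_comp_rpow hB hO))
  refine IsBigO.of_bound 1 ?_
  filter_upwards [hA', eventually_one_lt_log, eventually_ge_atTop 3] with r h1 h2 h3
  have hr0 : 0 < r := by linarith
  set n := centralIndex q a r
  have h4 := hterm n r hr0.le
  have hinv : 0 < (q ^ n)⁻¹ := inv_pos.2 (pow_pos hq n)
  -- The extra exponent 2 covers `r + 2T ≤ r²T`, valid for `r ≥ 3` and `T ≥ 1`.
  have h5 : r + 2 * (q ^ n)⁻¹ ≤ r ^ (A * -Real.log q + 2) := by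
    have h6 := inv_pow_le_rpow hq hq1 (by linarith) h1
    have h7 : 1 ≤ r ^ (A * -Real.log q) :=
      Real.one_le_rpow (by linarith) (by positivity)
    rw [Real.rpow_add hr0, Real.rpow_two]
    nlinarith [mul_le_mul_of_nonneg_left h7 hr0.le,
      mul_nonneg (zero_le_one.trans h7) (mul_nonneg hr0.le (sub_nonneg.2 h3)),
      mul_nonneg (zero_le_one.trans h7) (sub_nonneg.2 h3)]
  have h6 : maximalTerm q a r ≤ Real.exp (A * Real.log r)
      * maxModulus f (r ^ (A * -Real.log q + 2)) := by
    rw [← hν r hr0]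
    refine h4.trans (mul_le_mul ?_ (maxModulus_mono hf (by positivity) (by positivity) h5)
      (maxModulus_nonneg _ _) (Real.exp_pos _).le)
    calc (2 : ℝ) ^ n ≤ Real.exp 1 ^ n := by
          gcongr
          linarith [Real.add_one_le_exp (1 : ℝ)]
      _ = Real.exp n := by rw [← Real.exp_nat_mul, mul_one]
      _ ≤ _ := Real.exp_le_exp.2 h1
  have hμ0 : 0 ≤ maximalTerm q a r := by
    rw [← hν r hr0]; exact termSize_nonneg _ _ _ _
  have h7 := (Real.posLog_le_posLog hμ0 h6).trans Real.posLog_mul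
  have h8 : 0 ≤ A * Real.log r := by nlinarith
  rw [Real.posLog_eq_log (x := Real.exp _) (by
    rw [abs_of_pos (Real.exp_pos _)]; exact Real.one_le_exp h8), Real.log_exp] at h7
  rw [Real.norm_of_nonneg Real.posLog_nonneg, one_mul]
  exact h7.trans (le_abs_self _)

theorem pow_mul_phiMax_le (hq : 0 < q) (hq1 : q < 1) (n : ℕ) {r : ℝ} (hr : 1 ≤ r) :
    r ^ n * phiMax q n r ≤ phiMax q n (2 * r ^ 2 * (q ^ n)⁻¹) := by
  have h0 : r ^ n = ∏ j ∈ Finset.range n, r := by simp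
  unfold phiMax
  rw [h0, ← Finset.prod_mul_distrib]
  refine Finset.prod_le_prod (fun _ _ => by positivity) fun j hj => ?_
  have h1 : 1 ≤ (q ^ n)⁻¹ * q ^ j := by
    rw [inv_mul_eq_div, one_le_div (pow_pos hq n)]
    exact pow_le_pow_of_le_one hq.le hq1.le (Finset.mem_range.1 hj).le
  have h2 : q ^ (2 * j) ≤ 1 := pow_le_one₀ hq.le hq1.le
  have h3 : q ^ j ≤ 1 := pow_le_one₀ hq.le hq1.le
  have h4 : 0 < q ^ (2 * j) := by positivity
  calc r * (1 + 2 * r * q ^ j + q ^ (2 * j)) ≤ r * (1 + 2 * r * 1 + 1) := by gcongr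
    _ ≤ 4 * r ^ 2 * 1 := by nlinarith
    _ ≤ 4 * r ^ 2 * ((q ^ n)⁻¹ * q ^ j) := by gcongr
    _ ≤ _ := by linarith

/-- Following the maximal term at `r` out to a radius `r^B` multiplies it by at least `r^ν`, by
`pow_mul_phiMax_le`. Thus `ν ln r ≤ ln μ(r^B)`, and dividing by `ln r` lowers the exponent by one.
-/
theorem isBigO_centralIndex (hq : 0 < q) (hq1 : q < 1) (hA : 0 < A)
    (hν : ∀ r : ℝ, 0 < r → termSize q a (centralIndex q a r) r = maximalTerm q a r)
    (hA' : ∀ᶠ r in atTop, (centralIndex q a r : ℝ) ≤ A * Real.log r)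
    (hle : ∀ r : ℝ, 0 < r → ∀ n, termSize q a n r ≤ maximalTerm q a r)
    (hμ : ∀ B : ℝ, ∀ᶠ r in atTop, B < maximalTerm q a r)
    (hO : (fun r => Real.posLog (maximalTerm q a r)) =O[atTop] fun r => Real.log r ^ s) :
    (fun r => (centralIndex q a r : ℝ)) =O[atTop] fun r => Real.log r ^ (s - 1) := by
  have hL : 0 < -Real.log q := neg_pos.2 (Real.log_neg hq hq1)
  have hB : 0 < A * -Real.log q + 3 := by positivity
  obtain ⟨K, hK⟩ := (isBigO_log_rpow_comp_rpow hB hO).bound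
  refine IsBigO.of_bound K ?_
  filter_upwards [hK, hA', hμ 1, eventually_one_lt_log, eventually_ge_atTop 3]
    with r h0 h1 hμ1 h2 h3
  have hr0 : 0 < r := by linarith
  have hl0 : 0 < Real.log r := by linarith
  rw [Real.norm_of_nonneg Real.posLog_nonneg,
    Real.norm_of_nonneg (Real.rpow_nonneg hl0.le _)] at h0
  set n := centralIndex q a r
  have hinv : 0 < (q ^ n)⁻¹ := inv_pos.2 (pow_pos hq n)
  have h5 : 2 * r ^ 2 * (q ^ n)⁻¹ ≤ r ^ (A * -Real.log q + 3) := by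
    have h6 := inv_pow_le_rpow hq hq1 (by linarith) h1
    rw [Real.rpow_add hr0, mul_comm (r ^ _), show (3 : ℝ) = ((3 : ℕ) : ℝ) by norm_num,
      Real.rpow_natCast]
    gcongr
    nlinarith [sq_nonneg r]
  have h6 : r ^ n ≤ maximalTerm q a (r ^ (A * -Real.log q + 3)) := by
    calc r ^ n ≤ r ^ n * termSize q a n r :=
          le_mul_of_one_le_right (by positivity) (by rw [hν r hr0]; exact hμ1.le)
      _ = ‖a n‖ * (r ^ n * phiMax q n r) := by rw [termSize_eq hq a n hr0.le]; ring
      _ ≤ ‖a n‖ * phiMax q n (2 * r ^ 2 * (q ^ n)⁻¹) := by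
          gcongr
          exact pow_mul_phiMax_le hq hq1 n (by linarith)
      _ = termSize q a n (2 * r ^ 2 * (q ^ n)⁻¹) := (termSize_eq hq a n (by positivity)).symm
      _ ≤ termSize q a n (r ^ (A * -Real.log q + 3)) := termSize_mono hq a n (by positivity) h5
      _ ≤ _ := hle _ (by positivity) n
  have h7 : n * Real.log r ≤ K * Real.log r ^ s := by
    rw [← Real.log_pow]
    exact (Real.log_le_log (by positivity) h6).trans ((le_max_right _ _).trans h0)
  rw [Real.norm_natCast, Real.norm_of_nonneg (Real.rpow_nonneg hl0.le _)]
  rw [Real.rpow_sub_one hl0.ne', ← mul_div_assoc, le_div_iff₀ hl0]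
  exact h7

theorem isBigO_posLog_maximalTerm_of_centralIndex (hq : 0 < q) (hq1 : q < 1) (hc : 0 < c)
    (hC : 0 < C) (ha : ∀ n : ℕ, ‖a n‖ ≤ C * Real.exp (-c * n ^ 2))
    (hν : ∀ r : ℝ, 0 < r → termSize q a (centralIndex q a r) r = maximalTerm q a r) (hs : 1 ≤ s)
    (hO : (fun r => (centralIndex q a r : ℝ)) =O[atTop] fun r => Real.log r ^ (s - 1)) :
    (fun r => Real.posLog (maximalTerm q a r)) =O[atTop] fun r => Real.log r ^ s := by
  have hconst : (fun _ : ℝ => Real.posLog C) =O[atTop] fun r => Real.log r ^ s :=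
    Real.isLittleO_const_log_atTop.isBigO.trans (isBigO_log_log_rpow hs)
  have hprod : (fun r => (centralIndex q a r : ℝ) * (2 * Real.log r))
      =O[atTop] fun r => Real.log r ^ s := by
    refine (hO.mul ((isBigO_refl Real.log atTop).const_mul_left 2)).congr'
      EventuallyEq.rfl ?_
    filter_upwards [eventually_one_lt_log] with r hr
    have hl : Real.log r ≠ 0 := by linarith
    rw [Real.rpow_sub_one hl, div_mul_cancel₀ _ hl]
  refine IsBigO.trans (IsBigO.of_bound 1 ?_) (hconst.add hprod)
  filter_upwards [eventually_one_lt_log, eventually_ge_atTop 3] with r h2 h3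
  have hr0 : 0 < r := by linarith
  have hl0 : 0 < Real.log r := by linarith
  set n := centralIndex q a r
  have h4 : maximalTerm q a r ≤ C * Real.exp (n * (2 * Real.log r)) := by
    rw [← hν r hr0]
    refine (termSize_le hq hq1 ha n hr0.le).trans ?_
    gcongr
    rw [Real.exp_nat_mul]
    calc (2 + 2 * r) ^ n * Real.exp (-c * n ^ 2)
        ≤ Real.exp (2 * Real.log r) ^ n * 1 := by
          gcongr
          · exact two_add_two_mul_le h3
          · exact Real.exp_le_one_iff.2 (by nlinarith [sq_nonneg (n : ℝ)])
      _ = _ := mul_one _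
  have hμ0 : 0 ≤ maximalTerm q a r := by
    rw [← hν r hr0]; exact termSize_nonneg _ _ _ _
  have h7 := (Real.posLog_le_posLog hμ0 h4).trans Real.posLog_mul
  rw [Real.posLog_eq_log (x := Real.exp _) (by
    rw [abs_of_pos (Real.exp_pos _)]; exact Real.one_le_exp (by positivity)),
    Real.log_exp] at h7
  rw [Real.norm_of_nonneg Real.posLog_nonneg, one_mul]
  exact h7.trans (le_abs_self _)

theorem IsExpansion.exists_coeff_ne_zero (h : IsExpansion q f a)
    (hnc : ¬ ∃ c : ℂ, ∀ x : ℂ, f x = c) : ∃ n, 1 ≤ n ∧ a n ≠ 0 := by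
  by_contra! hall
  refine hnc ⟨a 0, fun x => ?_⟩
  have h1 := (h {x} isCompact_singleton).tendsto_at (Set.mem_singleton x)
  refine tendsto_nhds_unique h1 (tendsto_const_nhds.congr' ?_)
  filter_upwards [eventually_ge_atTop 1] with n hn
  rw [Finset.sum_eq_single_of_mem 0 (Finset.mem_range.2 hn)
    fun k _ hk => by rw [hall k (Nat.one_le_iff_ne_zero.2 hk), zero_mul]]
  simp [phi]

end Growth

end AskeyWilson

theorem theorem4p3 (q : ℝ) (hq0 : 0 < q) (hq1 : q < 1) (f : ℂ → ℂ)
    (hf : Differentiable ℂ f) (hnc : ¬ ∃ c : ℂ, ∀ x : ℂ, f x = c)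
    (hσ : AskeyWilson.logOrder (AskeyWilson.maxModulus f) < 2) :
    (∃! a : ℕ → ℂ, AskeyWilson.IsExpansion q f a) ∧
    ∀ a : ℕ → ℂ, AskeyWilson.IsExpansion q f a →
      -- the maximal term and the central index are genuine maxima
      (∀ r : ℝ, 0 < r →
        0 < AskeyWilson.maximalTerm q a r ∧
        IsGreatest (Set.range fun n : ℕ => AskeyWilson.termSize q a n r)
          (AskeyWilson.maximalTerm q a r) ∧
        IsGreatest {n : ℕ | AskeyWilson.termSize q a n r = AskeyWilson.maximalTerm q a r}
          (AskeyWilson.centralIndex q a r)) ∧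
      AskeyWilson.logOrder (AskeyWilson.maxModulus f) =
        AskeyWilson.logOrder (AskeyWilson.maximalTerm q a) ∧
      AskeyWilson.logOrder (AskeyWilson.maximalTerm q a) =
        1 + limsup (fun r : ℝ =>
          ((Real.log (AskeyWilson.centralIndex q a r : ℝ) / Real.log (Real.log r) : ℝ) : EReal))
          atTop := by
  open AskeyWilson in
  obtain ⟨c, hc, C, hC, hrem⟩ := exists_norm_newtonRem_le hq0 hq1 hf hσ
  have hexp := isExpansion_newtonCoeff hq0 hq1 hc hrem
  refine ⟨⟨_, hexp, fun b hb => hb.unique hq0 hq1 hexp⟩, fun a hae => ?_⟩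
  obtain rfl := hae.unique hq0 hq1 hexp
  have ha := norm_newtonCoeff_le hq0 hq1 hrem
  obtain ⟨m, hm, hm0⟩ := hexp.exists_coeff_ne_zero hnc
  have hκ := norm_pos_iff.2 hm0
  have htend : ∀ r : ℝ, 0 < r → Tendsto (fun n => termSize q (newtonCoeff q f) n r) atTop (𝓝 0) :=
    fun r hr => tendsto_termSize hq0 hq1 hc ha hr.le
  have hspec := fun (r : ℝ) (hr : 0 < r) => maximalTerm_spec (htend r hr)
    ((mul_pos hκ hr).trans_le (mul_le_termSize hq0 hm hr.le))
  have hle := fun (r : ℝ) (hr : 0 < r) => termSize_le_maximalTerm (htend r hr)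
  have hν := fun (r : ℝ) (hr : 0 < r) => (hspec r hr).2.2.1
  have hlin : ∀ᶠ r in atTop, ‖newtonCoeff q f m‖ * (r - 0) ≤ maximalTerm q (newtonCoeff q f) r := by
    filter_upwards [eventually_gt_atTop 0] with r hr
    rw [sub_zero]
    exact (mul_le_termSize hq0 hm hr.le).trans (hle r hr m)
  have hμ : ∀ B : ℝ, ∀ᶠ r in atTop, B < maximalTerm q (newtonCoeff q f) r := fun B =>
    ((tendsto_id.const_mul_atTop hκ).eventually_gt_atTop B).mp
      (hlin.mono fun r h1 h2 => by simpa using h2.trans_le (by simpa using h1))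
  have hAν := eventually_centralIndex_le hq0 hq1 hc hC ha hν hμ
  have hA : 0 < 2 / c := div_pos two_pos hc
  have hterm := fun (n : ℕ) (r : ℝ) (hr : 0 ≤ r) =>
    termSize_newtonCoeff_le hq0 hq1 hf n hr
  have hoμ := one_le_logOrder hκ hlin
  have hoM : 1 ≤ logOrder (maxModulus f) := by
    -- The coefficient estimate is used at radius `r - 2 q^(-m)`, so that its shifted radius is
    -- exactly `r`.
    refine one_le_logOrder (κ := ‖newtonCoeff q f m‖ / 2 ^ m) (c := 2 * (q ^ m)⁻¹)
      (by positivity) ?_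
    filter_upwards [eventually_ge_atTop (2 * (q ^ m)⁻¹)] with r hr
    have h1 := (mul_le_termSize hq0 hm (sub_nonneg.2 hr)).trans
      (hterm m _ (sub_nonneg.2 hr))
    rw [sub_add_cancel] at h1
    rw [div_mul_eq_mul_div, div_le_iff₀ (by positivity)]
    linarith
  refine ⟨hspec, le_antisymm ?_ ?_, ?_⟩
  · exact powLogOrder_le_powLogOrder hoμ fun s hs =>
      isBigO_posLog_maxModulus hq0 hq1 hc hC hrem hle hμ hs.le
  · exact powLogOrder_le_powLogOrder hoM fun s hs =>
      isBigO_posLog_maximalTerm hq0 hq1 hf hA hν hAν hterm hs.le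
  -- On naturals `log` and `posLog` coincide, including at 0, where both are 0.
  · simp_rw [← Real.log_of_nat_eq_posLog]
    exact powLogOrder_eq_one_add hoμ (powLogOrder_nonneg _)
      (fun s _ => isBigO_centralIndex hq0 hq1 hA hν hAν hle hμ)
      (fun s hs => isBigO_posLog_maximalTerm_of_centralIndex hq0 hq1 hc hC ha hν hs.le)
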